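/- Let $A\subset C$ and $B\subset D$ be unital inclusions of unital $C^*$-algebras which are strongly Morita equivalent with respect to a $C$-$D$-equivalence bimodule $Y$ and its closed subspace $X$; that is, $a\cdot x,\ x\cdot b\in X$, ${}_C\langle x,z\rangle\in A$ and $\langle x,z\rangle_D\in B$ for all $a\in A$, $b\in B$, $x,z\in X$, and $\overline{\operatorname{span}}\,{}_C\langle X,X\rangle=A$, $\overline{\operatorname{span}}\,\langle X,X\rangle_D=B$, $\overline{\operatorname{span}}\,{}_C\langle Y,X\rangle=C$, $\overline{\operatorname{span}}\,\langle Y,X\rangle_D=D$. Let ${}_A\mathbf B_A(C,A)$ and ${}_B\mathbf B_B(D,B)$ be the spaces of bounded $A$-bimodule linear maps $C\to A$ and of bounded $B$-bimodule linear maps $D\to B$. For $\phi\in{}_A\mathbf B_A(C,A)$ let $f(\phi)\in{}_B\mathbf B_B(D,B)$ be the second member $\psi$ of the unique pair consisting of a linear map $\tau:Y\to X$ and a $\psi\in{}_B\mathbf B_B(D,B)$ such that, for all $a\in A$, $b\in B$, $c\in C$, $d\in D$, $x\in X$, $y\in Y$, $$\tau(c\cdot x)=\phi(c)\cdot x,\quad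 \tau(a\cdot y)=a\cdot\tau(y),\quad {}_C\langle\tau(y),x\rangle=\phi({}_C\langle y,x\rangle),$$ $$\tau(x\cdot d)=x\cdot\psi(d),\quad \tau(y\cdot b)=\tau(y)\cdot b,\quad \psi(\langle x,y\rangle_D)=\langle x,\tau(y)\rangle_D .$$ Let $\phi$ be a conditional expectation from $C$ onto $A$ (a positive element of ${}_A\mathbf B_A(C,A)$ with $\phi(a)=a$ for all $a\in A$), and suppose that there is a number $t>0$ with $\phi(c)\ge tc$ for every positive $c\in C$. Then there is a number $s>0$ such that $f(\phi)(d)\ge sd$ for every positive $d\in D$. -/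

import Mathlib

open MulOpposite

namespace CStarInclusion

/-- The left `C`-valued inner product `_C⟨x, y⟩`, which is linear in the first variable and
satisfies `_C⟨c·x, y⟩ = c _C⟨x, y⟩`. (Mathlib's `inner C` is linear in its second variable and
satisfies `inner C x (c • y) = c * inner C x y`, so the two arguments are swapped.) -/
def leftInner (C : Type*) {Y : Type*} [CStarAlgebra C] [PartialOrder C]
    [NormedAddCommGroup Y] [NormedSpace ℂ Y] [Module C Y] [CStarModule C Y] (x y : Y) : C :=
  inner C y x

/-- The right `D`-valued inner product `⟨x, y⟩_D`, which is linear in the second variable and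
satisfies `⟨x, y·d⟩_D = ⟨x, y⟩_D d`. Here the right action `y·d` is `op d • y`. -/
def rightInner (D : Type*) {Y : Type*} [CStarAlgebra D] [PartialOrder D]
    [NormedAddCommGroup Y] [NormedSpace ℂ Y] [Module Dᵐᵒᵖ Y] [CStarModule Dᵐᵒᵖ Y] (x y : Y) : D :=
  unop (inner Dᵐᵒᵖ x y)

/-- `Y` is a `C`-`D`-equivalence (imprimitivity) bimodule. The Hilbert module structures on
both sides are the two `CStarModule` instances (they induce the same norm, for which `Y` is
complete); the remaining requirements are that both are full, that each algebra acts by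
adjointable operators for the other inner product, and `_C⟨x, y⟩·z = x·⟨y, z⟩_D`. -/
class IsEquivalenceBimodule (C D Y : Type*) [CStarAlgebra C] [PartialOrder C]
    [CStarAlgebra D] [PartialOrder D] [NormedAddCommGroup Y] [NormedSpace ℂ Y]
    [Module C Y] [Module Dᵐᵒᵖ Y] [CStarModule C Y] [CStarModule Dᵐᵒᵖ Y] : Prop where
  complete : CompleteSpace Y
  leftInner_smul (x y z : Y) : leftInner C x y • z = op (rightInner D y z) • x
  rightInner_smul_left (c : C) (x y : Y) :
    rightInner D (c • x) y = rightInner D x (star c • y)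
  leftInner_op_smul_left (d : D) (x y : Y) :
    leftInner C (op d • x) y = leftInner C x (op (star d) • y)
  left_full : closure
    (Submodule.span ℂ {c : C | ∃ x y : Y, leftInner C x y = c} : Set C) = Set.univ
  right_full : closure
    (Submodule.span ℂ {d : D | ∃ x y : Y, rightInner D x y = d} : Set D) = Set.univ

section Equivalence

variable {C D Y : Type*} [CStarAlgebra C] [PartialOrder C] [CStarAlgebra D] [PartialOrder D]
  [NormedAddCommGroup Y] [NormedSpace ℂ Y] [Module C Y] [Module Dᵐᵒᵖ Y]
  [CStarModule C Y] [CStarModule Dᵐᵒᵖ Y]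

/-- The unital inclusions of unital C⋆-algebras `A ⊆ C` and `B ⊆ D` are strongly Morita
equivalent with respect to the `C`-`D`-equivalence bimodule `Y` and its closed subspace `X`. -/
structure IsMoritaEquivalence (A : StarSubalgebra ℂ C) (B : StarSubalgebra ℂ D)
    (X : Submodule ℂ Y) : Prop where
  bimodule : IsEquivalenceBimodule C D Y
  isClosed_left : IsClosed (A : Set C)
  isClosed_right : IsClosed (B : Set D)
  isClosed_sub : IsClosed (X : Set Y)
  smul_mem : ∀ a ∈ A, ∀ x ∈ X, a • x ∈ X
  op_smul_mem : ∀ b ∈ B, ∀ x ∈ X, op b • x ∈ X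
  leftInner_mem : ∀ x ∈ X, ∀ z ∈ X, leftInner C x z ∈ A
  rightInner_mem : ∀ x ∈ X, ∀ z ∈ X, rightInner D x z ∈ B
  left_full : closure
    (Submodule.span ℂ {c : C | ∃ x ∈ X, ∃ z ∈ X, leftInner C x z = c} : Set C) = A
  right_full : closure
    (Submodule.span ℂ {d : D | ∃ x ∈ X, ∃ z ∈ X, rightInner D x z = d} : Set D) = B
  left_full_mixed : closure
    (Submodule.span ℂ {c : C | ∃ y : Y, ∃ x ∈ X, leftInner C y x = c} : Set C) = Set.univ
  right_full_mixed : closure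
    (Submodule.span ℂ {d : D | ∃ y : Y, ∃ x ∈ X, rightInner D y x = d} : Set D) = Set.univ

end Equivalence

/-- The space of bounded `A`-bimodule linear maps from `C` to `A`. -/
def bimoduleMaps {C : Type*} [CStarAlgebra C] (A : StarSubalgebra ℂ C) :
    Submodule ℂ (C →L[ℂ] A) where
  carrier := {φ | ∀ (a : A) (c : C), φ (a * c) = a * φ c ∧ φ (c * a) = φ c * a}
  add_mem' := fun {φ ψ} hφ hψ a c => by
    simp [(hφ a c).1, (hφ a c).2, (hψ a c).1, (hψ a c).2, mul_add, add_mul]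
  zero_mem' := fun a c => by simp
  smul_mem' := fun k φ hφ a c => by simp [(hφ a c).1, (hφ a c).2]

/-- A conditional expectation from `C` onto `A`: a bounded `A`-bimodule linear map `C → A` that is
positive and restricts to the identity on `A`. -/
structure IsConditionalExpectation {C : Type*} [CStarAlgebra C] [PartialOrder C]
    {A : StarSubalgebra ℂ C} (φ : bimoduleMaps A) : Prop where
  nonneg : ∀ c : C, 0 ≤ c → 0 ≤ (φ.1 c : C)
  apply_coe : ∀ a : A, φ.1 (a : C) = a

section Continuity

variable {C Y : Type*} [CStarAlgebra C] [PartialOrder C]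
  [NormedAddCommGroup Y] [NormedSpace ℂ Y] [Module C Y] [CStarModule C Y]

theorem continuous_smul_const [IsScalarTower ℂ C Y] (y : Y) : Continuous fun c : C => c • y := by
  let L : C →ₗ[ℂ] Y :=
    { toFun := fun c => c • y
      map_add' := fun a b => add_smul a b y
      map_smul' := fun k a => smul_assoc k a y }
  refine (L.mkContinuous ‖y‖ fun c => ?_).continuous
  refine le_of_sq_le_sq ?_ (by positivity)
  change ‖c • y‖ ^ 2 ≤ _
  rw [CStarModule.norm_sq_eq C, mul_pow, CStarModule.norm_sq_eq C,
    CStarModule.inner_op_smul_right, CStarModule.inner_op_smul_left]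
  calc ‖c * (inner C y y * star c)‖ ≤ ‖c‖ * (‖inner C y y‖ * ‖star c‖) :=
        (norm_mul_le _ _).trans (by gcongr; exact norm_mul_le _ _)
    _ = ‖inner C y y‖ * ‖c‖ ^ 2 := by rw [norm_star]; ring

variable [StarOrderedRing C]

theorem continuous_inner_right (x : Y) : Continuous fun y : Y => inner C x y :=
  (CStarModule.innerSL (A := C) x).continuous

theorem continuous_inner_left (x : Y) : Continuous fun y : Y => inner C y x := by
  have : (fun y : Y => inner C y x) = fun y => star (inner C x y) := by
    funext y; simp
  rw [this]
  exact (continuous_inner_right x).star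

end Continuity

section Transfer

variable {C D Y : Type*} [CStarAlgebra C] [PartialOrder C] [CStarAlgebra D] [PartialOrder D]
  [NormedAddCommGroup Y] [NormedSpace ℂ Y] [Module C Y] [Module Dᵐᵒᵖ Y]
  [CStarModule C Y] [CStarModule Dᵐᵒᵖ Y]

/-- The linear map `τ : Y → X` and the map `ψ : D → B` are the ones associated with the bounded
`A`-bimodule map `φ : C → A`. -/
structure IsTransfer {A : StarSubalgebra ℂ C} {B : StarSubalgebra ℂ D} {X : Submodule ℂ Y}
    (φ : bimoduleMaps A) (τ : Y →ₗ[ℂ] X) (ψ : bimoduleMaps B) : Prop where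
  map_smul_coe (c : C) (x : X) : (τ (c • (x : Y)) : Y) = (φ.1 c : C) • (x : Y)
  map_coe_smul (a : A) (y : Y) : (τ ((a : C) • y) : Y) = (a : C) • (τ y : Y)
  leftInner_map (y : Y) (x : X) : leftInner C (τ y : Y) (x : Y) = φ.1 (leftInner C y (x : Y))
  map_op_smul_coe (x : X) (d : D) : (τ (op d • (x : Y)) : Y) = op (ψ.1 d : D) • (x : Y)
  map_op_coe_smul (b : B) (y : Y) : (τ (op (b : D) • y) : Y) = op (b : D) • (τ y : Y)
  map_rightInner (x : X) (y : Y) :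
    (ψ.1 (rightInner D (x : Y) y) : D) = rightInner D (x : Y) (τ y : Y)

/-- A finite frame: `∑ ⟨u i, v i⟩_D = 1` with `u i, v i ∈ X`. -/
theorem IsMoritaEquivalence.exists_frame {A : StarSubalgebra ℂ C} {B : StarSubalgebra ℂ D}
    {X : Submodule ℂ Y} (h : IsMoritaEquivalence A B X) :
    ∃ (n : Type) (_ : Fintype n) (u v : n → X), ∑ i, rightInner D (u i : Y) (v i : Y) = 1 := by
  have key : ∀ b ∈ Submodule.span ℂ {d : D | ∃ x ∈ X, ∃ z ∈ X, rightInner D x z = d},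
      ∃ (n : Type) (_ : Fintype n) (u v : n → X),
        ∑ i, rightInner D (u i : Y) (v i : Y) = b := by
    intro b hb
    induction hb using Submodule.span_induction with
    | mem b hb =>
      obtain ⟨x, hx, z, hz, rfl⟩ := hb
      exact ⟨Unit, inferInstance, fun _ => ⟨x, hx⟩, fun _ => ⟨z, hz⟩, by simp⟩
    | zero => exact ⟨Empty, inferInstance, fun i => i.elim, fun i => i.elim, by simp⟩
    | add a b _ _ ha hb =>
      obtain ⟨n, _, u, v, rfl⟩ := ha
      obtain ⟨m, _, u', v', rfl⟩ := hb
      exact ⟨n ⊕ m, inferInstance, Sum.elim u u', Sum.elim v v', by simp⟩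
    | smul k b _ hb =>
      obtain ⟨n, _, u, v, rfl⟩ := hb
      exact ⟨n, inferInstance, u, fun i => k • v i, by simp [rightInner, Finset.smul_sum]⟩
  have h1 : (1 : D) ∈ closure
      (Submodule.span ℂ {d : D | ∃ x ∈ X, ∃ z ∈ X, rightInner D x z = d} : Set D) := by
    rw [h.right_full]; exact one_mem B
  obtain ⟨b, hb, hb1⟩ := Metric.mem_closure_iff.1 h1 1 one_pos
  have hbB : b ∈ B := by
    have := subset_closure hb
    rwa [h.right_full] at this
  have := h.isClosed_right
  have : CompleteSpace B := h.isClosed_right.completeSpace_coe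
  let u := Units.oneSub (1 - (⟨b, hbB⟩ : B)) (by
    rw [dist_eq_norm] at hb1; simpa using hb1)
  have hu : b * ((u⁻¹ : Bˣ) : B) = 1 := by
    have : (u : B) = ⟨b, hbB⟩ := by simp [u]
    have h2 := u.mul_inv
    rw [this] at h2
    exact congrArg Subtype.val h2
  obtain ⟨n, _, p, q, rfl⟩ := key b hb
  refine ⟨n, inferInstance, p,
    fun i => ⟨op ((u⁻¹ : Bˣ) : D) • (q i : Y), h.op_smul_mem _ (Subtype.coe_prop _) _ (q i).2⟩, ?_⟩
  rw [← hu, Finset.sum_mul]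
  simp [rightInner]

variable [StarOrderedRing C] [StarOrderedRing D]
  [IsScalarTower ℂ C Y] [IsScalarTower ℂ Dᵐᵒᵖ Y] [SMulCommClass C Dᵐᵒᵖ Y]

/-- For every bounded `A`-bimodule map `φ : C → A` there is exactly one pair `(τ, ψ)` associated
with it. -/
theorem IsMoritaEquivalence.existsUnique_transfer
    {A : StarSubalgebra ℂ C} {B : StarSubalgebra ℂ D}
    {X : Submodule ℂ Y} (h : IsMoritaEquivalence A B X) (φ : bimoduleMaps A) :
    ∃! p : (Y →ₗ[ℂ] X) × bimoduleMaps B, IsTransfer φ p.1 p.2 := by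
  obtain ⟨n, _, u, v, huv⟩ := h.exists_frame
  have hY := h.bimodule
  have hcomm := SMulCommClass.symm C Dᵐᵒᵖ Y
  have hcompat := hY.leftInner_smul
  have l_add (x y z : Y) : leftInner C (x + y) z = leftInner C x z + leftInner C y z := by
    simp [leftInner]
  have l_smulc (k : ℂ) (x z : Y) : leftInner C (k • x) z = k • leftInner C x z := by
    simp [leftInner]
  have l_smul (c : C) (x z : Y) : leftInner C (c • x) z = c * leftInner C x z := by
    simp [leftInner]
  have l_sum (w : n → Y) (z : Y) : leftInner C (∑ i, w i) z = ∑ i, leftInner C (w i) z := by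
    simp [leftInner]
  have φ_left (a : C) (ha : a ∈ A) (c : C) : (φ.1 (a * c) : C) = a * φ.1 c :=
    congrArg Subtype.val (φ.2 ⟨a, ha⟩ c).1
  have φ_right (a : C) (ha : a ∈ A) (c : C) : (φ.1 (c * a) : C) = φ.1 c * a :=
    congrArg Subtype.val (φ.2 ⟨a, ha⟩ c).2
  have expand (y : Y) : ∑ i, leftInner C y (u i : Y) • (v i : Y) = y := by
    simp_rw [hcompat]
    have : ∑ i, op (rightInner D (u i : Y) (v i : Y)) = (1 : Dᵐᵒᵖ) := by
      rw [← op_one, ← huv]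
      exact (map_sum (opAddEquiv : D ≃+ Dᵐᵒᵖ) _ _).symm
    rw [← Finset.sum_smul, this, one_smul]
  -- the map `τ`
  let τ : Y →ₗ[ℂ] X :=
    { toFun := fun y => ∑ i, ⟨(φ.1 (leftInner C y (u i : Y)) : C) • (v i : Y),
        h.smul_mem _ (Subtype.coe_prop _) _ (v i).2⟩
      map_add' := fun x y => by
        ext; simp [l_add, add_smul, Finset.sum_add_distrib]
      map_smul' := fun k x => by
        ext; simp [l_smulc, Finset.smul_sum] }
  have τ_apply (y : Y) : (τ y : Y) = ∑ i, (φ.1 (leftInner C y (u i : Y)) : C) • (v i : Y) := by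
    simp [τ]
  have τ1 (c : C) (x : X) : (τ (c • (x : Y)) : Y) = (φ.1 c : C) • (x : Y) := by
    conv_rhs => rw [← expand (x : Y)]
    rw [τ_apply, Finset.smul_sum]
    refine Finset.sum_congr rfl fun i _ => ?_
    rw [l_smul, φ_right _ (h.leftInner_mem _ x.2 _ (u i).2), mul_smul]
  have τ2 (a : C) (ha : a ∈ A) (y : Y) : (τ (a • y) : Y) = a • (τ y : Y) := by
    rw [τ_apply, τ_apply, Finset.smul_sum]
    refine Finset.sum_congr rfl fun i _ => ?_
    rw [l_smul, φ_left _ ha, mul_smul]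
  have τ3 (y : Y) (x : X) :
      leftInner C (τ y : Y) (x : Y) = φ.1 (leftInner C y (x : Y)) := by
    conv_rhs => rw [← expand y]
    rw [τ_apply, l_sum, l_sum, map_sum, AddSubmonoidClass.coe_finsetSum]
    refine Finset.sum_congr rfl fun i _ => ?_
    rw [l_smul, l_smul, φ_right _ (h.leftInner_mem _ (v i).2 _ x.2)]
  have τ_cont : Continuous fun y => (τ y : Y) := by
    simp_rw [τ_apply]
    refine continuous_finsetSum _ fun i _ => ?_
    exact (continuous_smul_const (v i : Y)).comp (continuous_subtype_val.comp
      (φ.1.continuous.comp (continuous_inner_right (u i : Y))))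
  have r_add (x y z : Y) : rightInner D x (y + z) = rightInner D x y + rightInner D x z := by
    simp [rightInner]
  have r_smulc (k : ℂ) (x z : Y) : rightInner D x (k • z) = k • rightInner D x z := by
    simp [rightInner]
  have r_smul (d : D) (x z : Y) : rightInner D x (op d • z) = rightInner D x z * d := by
    simp [rightInner]
  have op_sum (w : n → D) (y : Y) : op (∑ i, w i) • y = ∑ i, op (w i) • y := by
    rw [← Finset.sum_smul]
    exact congrArg (· • y) (map_sum (opAddEquiv : D ≃+ Dᵐᵒᵖ) _ _)
  have op_mul_smul (d e : D) (y : Y) : op (d * e) • y = op e • (op d • y) := by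
    rw [op_mul, mul_smul]
  -- elements of `D` are determined by their right action on `X`
  have faithful (d e : D) (hde : ∀ x : X, op d • (x : Y) = op e • (x : Y)) : d = e := by
    have key (d : D) : d = ∑ i, rightInner D (u i : Y) (op d • (v i : Y)) := by
      simp_rw [r_smul, ← Finset.sum_mul, huv, one_mul]
    rw [key d, key e]
    simp_rw [hde]
  -- the map `ψ`
  let ψ₀ : D →ₗ[ℂ] B :=
    { toFun := fun d => ∑ i, ⟨rightInner D (u i : Y) (τ (op d • (v i : Y)) : Y),
        h.rightInner_mem _ (u i).2 _ (Subtype.coe_prop _)⟩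
      map_add' := fun d e => by
        ext; simp [r_add, add_smul, Finset.sum_add_distrib]
      map_smul' := fun k d => by
        ext; simp [r_smulc, Finset.smul_sum] }
  have ψ_apply (d : D) :
      (ψ₀ d : D) = ∑ i, rightInner D (u i : Y) (τ (op d • (v i : Y)) : Y) := by
    simp [ψ₀]
  have ψ_cont : Continuous ψ₀ := by
    refine continuous_induced_rng.2 ?_
    change Continuous fun d => (ψ₀ d : D)
    simp_rw [ψ_apply]
    refine continuous_finsetSum _ fun i _ => ?_
    exact continuous_unop.comp ((continuous_inner_right (u i : Y)).comp
      (τ_cont.comp ((continuous_smul_const (v i : Y)).comp continuous_op)))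
  have τ4 (x : X) (d : D) : (τ (op d • (x : Y)) : Y) = op (ψ₀ d : D) • (x : Y) := by
    rw [ψ_apply, op_sum]
    simp_rw [← hcompat]
    conv_lhs => rw [← expand (x : Y), Finset.smul_sum, map_sum, AddSubmonoidClass.coe_finsetSum]
    refine Finset.sum_congr rfl fun i _ => ?_
    rw [smul_comm, τ2 _ (h.leftInner_mem _ x.2 _ (u i).2)]
  have τ6 (x : X) (y : Y) :
      (ψ₀ (rightInner D (x : Y) y) : D) = rightInner D (x : Y) (τ y : Y) := by
    refine faithful _ _ fun z => ?_
    rw [← τ4, ← hcompat, τ2 _ (h.leftInner_mem _ z.2 _ x.2), hcompat]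
  have τ5 (b : D) (hb : b ∈ B) (y : Y) : (τ (op b • y) : Y) = op b • (τ y : Y) := by
    have e := expand y
    rw [← e, Finset.smul_sum, map_sum, map_sum, AddSubmonoidClass.coe_finsetSum,
      AddSubmonoidClass.coe_finsetSum, Finset.smul_sum]
    refine Finset.sum_congr rfl fun i _ => ?_
    have := τ1 (leftInner C y (u i : Y)) ⟨op b • (v i : Y), h.op_smul_mem _ hb _ (v i).2⟩
    rw [smul_comm, this, τ1, smul_comm]
  have ψ_mem : (⟨ψ₀, ψ_cont⟩ : D →L[ℂ] B) ∈ bimoduleMaps B := by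
    intro b d
    constructor
    · refine Subtype.ext (faithful _ _ fun x => ?_)
      have := τ4 ⟨op (b : D) • (x : Y), h.op_smul_mem _ b.2 _ x.2⟩ d
      change op (ψ₀ (b * d) : D) • (x : Y) = op ((b : D) * (ψ₀ d : D)) • (x : Y)
      rw [← τ4, op_mul_smul, op_mul_smul, this]
    · refine Subtype.ext (faithful _ _ fun x => ?_)
      change op (ψ₀ (d * b) : D) • (x : Y) = op ((ψ₀ d : D) * (b : D)) • (x : Y)
      rw [← τ4, op_mul_smul, op_mul_smul, τ5 _ b.2, τ4]
  refine ⟨(τ, ⟨⟨ψ₀, ψ_cont⟩, ψ_mem⟩),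
    ⟨τ1, fun a y => τ2 a a.2 y, τ3, τ4, fun b y => τ5 b b.2 y, τ6⟩, ?_⟩
  rintro ⟨τ', ψ'⟩ h'
  have hτ : τ' = τ := by
    ext y
    rw [← sub_eq_zero, ← CStarModule.inner_self (A := C)]
    have e : leftInner C (τ' y : Y) ((τ' y - τ y : X) : Y)
        = leftInner C (τ y : Y) ((τ' y - τ y : X) : Y) := by
      rw [τ3, h'.leftInner_map]
    rw [← AddSubgroupClass.coe_sub]
    simp only [leftInner] at e
    conv_lhs => rw [AddSubgroupClass.coe_sub, CStarModule.inner_sub_right,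
      ← AddSubgroupClass.coe_sub]
    rw [e, sub_self]
  refine Prod.ext hτ (Subtype.ext (ContinuousLinearMap.ext fun d =>
    Subtype.ext (faithful _ _ fun x => ?_)))
  change op (ψ'.1 d : D) • (x : Y) = op (ψ₀ d : D) • (x : Y)
  rw [← τ4, ← h'.map_op_smul_coe, hτ]

/-- The map `f` from bounded `A`-bimodule maps `C → A` to bounded `B`-bimodule maps `D → B`
induced by `(X, Y)`: `f φ` is the `ψ` of the unique pair `(τ, ψ)` associated with `φ`. -/
noncomputable def IsMoritaEquivalence.transfer
    {A : StarSubalgebra ℂ C} {B : StarSubalgebra ℂ D}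
    {X : Submodule ℂ Y} (h : IsMoritaEquivalence A B X) (φ : bimoduleMaps A) : bimoduleMaps B :=
  (h.existsUnique_transfer φ).choose.2

end Transfer

end CStarInclusion

namespace CStarInclusion

/-! Write `ψ` for the transfer of `φ`. Everything rests on the identity `⟨x·ψ(d), z⟩ = φ(⟨x·d, z⟩)`
for `x, z ∈ X` (left inner products). It makes `ψ` positive, since positivity in `B` can be tested
on `X`. With `φ ≥ t` it also gives `t‖x·√d‖² ≤ ‖ψ(d)‖‖x‖²`, which a finite frame in `X` turns into
`‖d‖ ≤ K‖ψ(d)‖` for `d ≥ 0`.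

The order bound cannot be tested on `X` in the same way: `ψ(d) - s d` need not lie in `B`, so its
negative part may move `X` out of itself. Instead the norm bound is applied to `r d r`, where `r =
(ψ(d) + ε)^(-1/2)` lies in `B`. The bimodule property gives `ψ(r d r) = r ψ(d) r ≤ 1`, hence `r d r
≤ K` and `d ≤ K(ψ(d) + ε)`; then `ε → 0`. -/

theorem norm_smul_le_of_cstarModule {C Y : Type*} [CStarAlgebra C] [PartialOrder C]
    [NormedAddCommGroup Y] [NormedSpace ℂ Y] [Module C Y] [CStarModule C Y] (c : C) (y : Y) :
    ‖c • y‖ ≤ ‖c‖ * ‖y‖ := by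
  refine le_of_sq_le_sq ?_ (by positivity)
  rw [CStarModule.norm_sq_eq C, mul_pow, CStarModule.norm_sq_eq C (x := y),
    CStarModule.inner_op_smul_right, CStarModule.inner_op_smul_left]
  calc ‖c * (inner C y y * star c)‖ ≤ ‖c‖ * (‖inner C y y‖ * ‖star c‖) :=
        (norm_mul_le _ _).trans (by gcongr; exact norm_mul_le _ _)
    _ = ‖c‖ ^ 2 * ‖inner C y y‖ := by rw [norm_star]; ring

/-! ### Testing elements of `D` and `B` on `X`. -/

section Frame

variable {C D Y : Type*} [CStarAlgebra C] [PartialOrder C] [CStarAlgebra D] [PartialOrder D]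
  [NormedAddCommGroup Y] [NormedSpace ℂ Y] [Module C Y] [Module Dᵐᵒᵖ Y]
  [CStarModule C Y] [CStarModule Dᵐᵒᵖ Y]
  {A : StarSubalgebra ℂ C} {B : StarSubalgebra ℂ D} {X : Submodule ℂ Y}

/-- Elements of `D` are determined by their right action on `X`. -/
theorem IsMoritaEquivalence.eq_zero_of_forall_op_smul (h : IsMoritaEquivalence A B X) {d : D}
    (hd : ∀ x ∈ X, op d • x = 0) : d = 0 := by
  obtain ⟨n, _, u, v, huv⟩ := h.exists_frame
  have key : d = ∑ i, rightInner D (u i : Y) (op d • (v i : Y)) := by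
    have (i : n) : rightInner D (u i : Y) (op d • (v i : Y)) =
        rightInner D (u i : Y) (v i : Y) * d := by simp [rightInner]
    simp_rw [this, ← Finset.sum_mul, huv, one_mul]
  rw [key]
  exact Finset.sum_eq_zero fun i _ => by rw [hd _ (v i).2]; simp [rightInner]

/-- The frame recovers `d` as `∑ ⟨u i, v i · d⟩`, so Cauchy–Schwarz bounds `‖d‖` by the norm of its
right action on `X` alone, up to a constant independent of `d`. -/
theorem IsMoritaEquivalence.exists_norm_le [StarOrderedRing D] (h : IsMoritaEquivalence A B X) :
    ∃ K : ℝ, 0 ≤ K ∧ ∀ (d : D) (M : ℝ), 0 ≤ M → (∀ x ∈ X, ‖op d • x‖ ≤ M * ‖x‖) →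
      ‖d‖ ≤ K * M := by
  obtain ⟨n, _, u, v, huv⟩ := h.exists_frame
  refine ⟨∑ i, ‖u i‖ * ‖v i‖, by positivity, fun d M hM hd => ?_⟩
  have key : d = ∑ i, rightInner D (u i : Y) (op d • (v i : Y)) := by
    have (i : n) : rightInner D (u i : Y) (op d • (v i : Y)) =
        rightInner D (u i : Y) (v i : Y) * d := by simp [rightInner]
    simp_rw [this, ← Finset.sum_mul, huv, one_mul]
  rw [key, Finset.sum_mul]
  refine norm_sum_le_of_le _ fun i _ => ?_
  calc ‖rightInner D (u i : Y) (op d • (v i : Y))‖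
      ≤ ‖(u i : Y)‖ * ‖op d • (v i : Y)‖ := by
        rw [rightInner, MulOpposite.norm_unop]
        exact CStarModule.norm_inner_le Y
    _ ≤ ‖(u i : Y)‖ * (M * ‖(v i : Y)‖) := by gcongr; exact hd _ (v i).2
    _ = ‖u i‖ * ‖v i‖ * M := by rw [Submodule.coe_norm, Submodule.coe_norm]; ring

theorem IsMoritaEquivalence.leftInner_op_smul (h : IsMoritaEquivalence A B X) (d : D) (x y : Y) :
    leftInner C (op d • x) y = leftInner C x (op (star d) • y) :=
  h.bimodule.leftInner_op_smul_left d x y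

theorem IsMoritaEquivalence.leftInner_op_mul_self_smul (h : IsMoritaEquivalence A B X) {e : D}
    (he : IsSelfAdjoint e) (x : Y) :
    leftInner C (op (e * e) • x) x = leftInner C (op e • x) (op e • x) := by
  rw [op_mul, mul_smul, h.leftInner_op_smul, he.star_eq]

theorem leftInner_self_nonneg (x : Y) : 0 ≤ leftInner C x x := CStarModule.inner_self_nonneg

theorem IsMoritaEquivalence.leftInner_op_smul_self_nonneg [StarOrderedRing D]
    (h : IsMoritaEquivalence A B X) {d : D}
    (hd : 0 ≤ d) (x : Y) : 0 ≤ leftInner C (op d • x) x := by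
  rw [← CFC.sqrt_mul_sqrt_self d hd,
    h.leftInner_op_mul_self_smul (IsSelfAdjoint.of_nonneg (CFC.sqrt_nonneg d))]
  exact leftInner_self_nonneg _

theorem leftInner_sub_left (x y z : Y) :
    leftInner C (x - y) z = leftInner C x z - leftInner C y z := by
  simp [leftInner]

/-- Since `b ∈ B` preserves `X`, the choice `z = x·b` is allowed and forces `x·b = 0`. -/
theorem IsMoritaEquivalence.eq_zero_of_leftInner (h : IsMoritaEquivalence A B X) {b : D}
    (hb : b ∈ B) (hx : ∀ x ∈ X, ∀ z ∈ X, leftInner C (op b • x) z = 0) : b = 0 := by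
  refine h.eq_zero_of_forall_op_smul fun x hxX => ?_
  exact CStarModule.inner_self.1 (hx x hxX _ (h.op_smul_mem b hb x hxX))

/-- A self-adjoint element of `B` whose compressions by elements of `X` are positive is
positive. -/
theorem IsMoritaEquivalence.nonneg_of_leftInner_nonneg [StarOrderedRing C] [StarOrderedRing D]
    (h : IsMoritaEquivalence A B X) {b : D}
    (hb : b ∈ B) (hsa : IsSelfAdjoint b)
    (hx : ∀ x ∈ X, 0 ≤ leftInner C (op b • x) x) : 0 ≤ b := by
  have := h.isClosed_right
  have hk : 0 ≤ b⁻ := CFC.negPart_nonneg b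
  have hkB : b⁻ ∈ B := cfcₙ_mem (𝕜 := ℝ) (𝕜' := ℂ) _ hb
  rw [← CFC.negPart_eq_zero_iff b hsa]
  set k := b⁻ with hkdef
  -- The vectors `x·k` stay in `X` because `k ∈ B`. Testing `b` on them sees only the negative part,
  -- giving `-⟨x·km, x·km⟩ ≥ 0` with `m = √k`, so `k m = 0`.
  have hkb : k * b = -(k * k) := by
    conv_lhs => rw [← CFC.posPart_sub_negPart b hsa]
    rw [mul_sub, CFC.negPart_mul_posPart, zero_sub]
  set m := CFC.sqrt k
  have hm : IsSelfAdjoint m := IsSelfAdjoint.of_nonneg (CFC.sqrt_nonneg k)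
  have hmm : m * m = k := CFC.sqrt_mul_sqrt_self k hk
  have hzero : k * m = 0 := by
    refine h.eq_zero_of_forall_op_smul fun x hxX => ?_
    have h1 := hx _ (h.op_smul_mem k hkB x hxX)
    have h2 := h.leftInner_op_mul_self_smul hm (op k • x)
    rw [hmm, ← mul_smul, ← op_mul] at h2
    rw [← mul_smul, ← op_mul, hkb, op_neg, neg_smul, ← zero_sub, leftInner_sub_left, h2] at h1
    have h3 : leftInner C (0 : Y) (op k • x) = 0 := by simp [leftInner]
    rw [h3, zero_sub, Left.nonneg_neg_iff] at h1
    rw [op_mul, mul_smul]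
    exact CStarModule.inner_self.1 (le_antisymm h1 (leftInner_self_nonneg _))
  have hkk : k * k = 0 := by rw [← hmm, ← mul_assoc, hmm, hzero, zero_mul]
  rw [← CStarRing.star_mul_self_eq_zero_iff, (IsSelfAdjoint.of_nonneg hk).star_eq, hkk]

/-! ### Positivity and norm lower bound for the transfer. -/

variable {φ : bimoduleMaps A} {τ : Y →ₗ[ℂ] X} {ψ : bimoduleMaps B}

theorem IsTransfer.leftInner_op_smul (hT : IsTransfer φ τ ψ) (d : D) {x z : Y}
    (hx : x ∈ X) (hz : z ∈ X) :
    leftInner C (op (ψ.1 d : D) • x) z = φ.1 (leftInner C (op d • x) z) := by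
  rw [← hT.map_op_smul_coe ⟨x, hx⟩, hT.leftInner_map _ ⟨z, hz⟩]

variable [StarOrderedRing C] [StarOrderedRing D]

/-- The transfer of a positive bimodule map is positive. -/
theorem IsTransfer.nonneg [IsScalarTower ℂ Dᵐᵒᵖ Y] (hT : IsTransfer φ τ ψ) (h : IsMoritaEquivalence A B X)
    (hφ : ∀ c : C, 0 ≤ c → 0 ≤ (φ.1 c : C)) {d : D} (hd : 0 ≤ d) : 0 ≤ (ψ.1 d : D) := by
  have key {x : Y} (hx : x ∈ X) : 0 ≤ leftInner C (op (ψ.1 d : D) • x) x := by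
    rw [hT.leftInner_op_smul d hx hx]
    exact hφ _ (h.leftInner_op_smul_self_nonneg hd x)
  refine h.nonneg_of_leftInner_nonneg (ψ.1 d).2 ?_ fun x hx => key hx
  set g : D := (ψ.1 d : D)
  -- Self-adjointness of `g`: the form `⟨x·g, x⟩` is positive, hence self-adjoint, so the form of
  -- `star g - g` vanishes on the diagonal of `X`.
  have hw : star g - g ∈ B := sub_mem (star_mem (ψ.1 d).2) (ψ.1 d).2
  set w := star g - g
  have hq (x : Y) (hx : x ∈ X) : leftInner C (op w • x) x = 0 := by
    have h1 : star (leftInner C (op g • x) x) = leftInner C (op g • x) x :=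
      (IsSelfAdjoint.of_nonneg (key hx)).star_eq
    have h2 : leftInner C (op (star g) • x) x = star (leftInner C (op g • x) x) := by
      rw [h.leftInner_op_smul, star_star]
      simp [leftInner]
    rw [op_sub, sub_smul, leftInner_sub_left, h2, h1, sub_self]
  have hw0 : w = 0 := by
    refine h.eq_zero_of_leftInner hw fun x hx z hz => ?_
    -- Complex polarization: the vectors `x + z` and `x + i z` give two relations between the cross
    -- terms, which together make them vanish.
    have e1 := hq _ (X.add_mem hx hz)
    have e2 := hq _ (X.add_mem hx (X.smul_mem Complex.I hz))
    have hI : op w • (Complex.I • z) = Complex.I • (op w • z) := by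
      have := IsScalarTower.to_smulCommClass' (R := ℂ) (A := Dᵐᵒᵖ) (M := Y)
      exact smul_comm _ _ _
    have a1 := hq x hx
    have a2 := hq z hz
    rw [smul_add] at e1 e2
    rw [hI] at e2
    simp only [leftInner, CStarModule.inner_add_left, CStarModule.inner_add_right,
      CStarModule.inner_smul_left_complex, CStarModule.inner_smul_right_complex] at e1 e2 a1 a2 ⊢
    rw [a1, a2] at e1 e2
    have e1' : inner C x (op w • z) = - inner C z (op w • x) := by
      rw [eq_neg_iff_add_eq_zero, add_comm]; simpa using e1
    rw [e1'] at e2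
    have e3 : (Complex.I * 2) • inner C z (op w • x) = 0 := by
      rw [← neg_eq_zero, ← e2]
      simp
      module
    exact (smul_eq_zero.1 e3).resolve_left (by simp)
  exact sub_eq_zero.1 hw0

/-- If `φ c ≥ t c` for positive `c`, then the transfer of `φ` is bounded below on positive
elements. -/
theorem IsTransfer.exists_norm_le (hT : IsTransfer φ τ ψ) (h : IsMoritaEquivalence A B X)
    {t : ℝ} (ht : 0 < t) (hφ : ∀ c : C, 0 ≤ c → t • c ≤ (φ.1 c : C)) :
    ∃ K : ℝ, 0 ≤ K ∧ ∀ d : D, 0 ≤ d → ‖d‖ ≤ K * ‖ψ.1 d‖ := by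
  obtain ⟨K, hK, hKd⟩ := h.exists_norm_le
  -- The frame bound is applied to `√d`, with `M = √(‖ψ(d)‖ / t)`, and then squared.
  refine ⟨K ^ 2 / t, by positivity, fun d hd => ?_⟩
  set e := CFC.sqrt d
  have he : IsSelfAdjoint e := IsSelfAdjoint.of_nonneg (CFC.sqrt_nonneg d)
  have hee : e * e = d := CFC.sqrt_mul_sqrt_self d hd
  have hbound (x : Y) (hx : x ∈ X) : ‖op e • x‖ ≤ √(‖ψ.1 d‖ / t) * ‖x‖ := by
    refine le_of_sq_le_sq ?_ (by positivity)
    rw [mul_pow, Real.sq_sqrt (by positivity), div_mul_eq_mul_div, le_div_iff₀ ht]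
    have h1 : ‖op e • x‖ ^ 2 = ‖leftInner C (op d • x) x‖ := by
      rw [← hee, h.leftInner_op_mul_self_smul he]
      exact CStarModule.norm_sq_eq C
    have h0 := h.leftInner_op_smul_self_nonneg hd x
    have h2 := CStarAlgebra.norm_le_norm_of_nonneg_of_le (smul_nonneg ht.le h0) (hφ _ h0)
    rw [norm_smul, Real.norm_of_nonneg ht.le, ← hT.leftInner_op_smul d hx hx] at h2
    calc ‖op e • x‖ ^ 2 * t = t * ‖leftInner C (op d • x) x‖ := by rw [h1, mul_comm]
      _ ≤ ‖leftInner C (op (ψ.1 d : D) • x) x‖ := h2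
      _ ≤ ‖x‖ * ‖op (ψ.1 d : D) • x‖ := CStarModule.norm_inner_le Y
      _ ≤ ‖x‖ * (‖op (ψ.1 d : D)‖ * ‖x‖) := by gcongr; exact norm_smul_le_of_cstarModule _ _
      _ = ‖ψ.1 d‖ * ‖x‖ ^ 2 := by rw [MulOpposite.norm_op]; change ‖x‖ * (‖ψ.1 d‖ * ‖x‖) = _; ring
  have h3 := hKd e _ (by positivity) hbound
  calc ‖d‖ = ‖e‖ ^ 2 := by rw [← hee, he.norm_mul_self]
    _ ≤ (K * √(‖ψ.1 d‖ / t)) ^ 2 := by gcongr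
    _ = K ^ 2 / t * ‖ψ.1 d‖ := by rw [mul_pow, Real.sq_sqrt (by positivity)]; ring

end Frame

/-! ### From a norm bound to an order bound. -/

/-- A positive bimodule map that is bounded below in norm on positive elements dominates a
multiple of the identity. -/
theorem le_smul_of_norm_le {D : Type*} [CStarAlgebra D] [PartialOrder D] [StarOrderedRing D]
    {B : StarSubalgebra ℂ D} (hB : IsClosed (B : Set D)) (ψ : bimoduleMaps B)
    (hψ : ∀ d : D, 0 ≤ d → 0 ≤ (ψ.1 d : D)) {K : ℝ} (hK : 0 ≤ K)
    (hn : ∀ d : D, 0 ≤ d → ‖d‖ ≤ K * ‖ψ.1 d‖) {d : D} (hd : 0 ≤ d) :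
    d ≤ K • (ψ.1 d : D) := by
  set g : D := (ψ.1 d : D) with hgdef
  have hg : 0 ≤ g := hψ d hd
  -- Adding `ε` makes `g` invertible, so that the power `-1/2` is available.
  have main (ε : ℝ) (hε : 0 < ε) : d ≤ K • (g + algebraMap ℝ D ε) := by
    set a := g + algebraMap ℝ D ε with hadef
    have hεp : IsStrictlyPositive (algebraMap ℝ D ε) :=
      isStrictlyPositive_algebraMap hε
    have ha : IsStrictlyPositive a := hεp.nonneg_add hg
    have haB : a ∈ B := add_mem (ψ.1 d).2 (by
      rw [IsScalarTower.algebraMap_apply ℝ ℂ D]; exact algebraMap_mem B _)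
    set r := a ^ (-(1 / 2) : ℝ)
    set q := a ^ ((1 / 2) : ℝ)
    have hr0 : 0 ≤ r := CFC.rpow_nonneg
    have hq0 : 0 ≤ q := CFC.rpow_nonneg
    have hr : IsSelfAdjoint r := IsSelfAdjoint.of_nonneg hr0
    have hq : IsSelfAdjoint q := IsSelfAdjoint.of_nonneg hq0
    have hrq : r * q = 1 := CFC.rpow_neg_mul_rpow _ ha
    have hqr : q * r = 1 := CFC.rpow_mul_rpow_neg _ ha
    have hqq : q * q = a := by
      rw [← CFC.rpow_add ha.isUnit]
      norm_num
      exact CFC.rpow_one a ha.nonneg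
    -- Closed subalgebras are stable under functional calculus; `r ∈ B` is what lets `r` be pulled
    -- out of `ψ`.
    have hrB : r ∈ B := by
      change a ^ (-(1 / 2) : ℝ) ∈ B
      rw [CFC.rpow_eq_cfc_real ha.nonneg]
      exact cfc_mem (𝕜 := ℝ) (𝕜' := ℂ) (hs := hB) _ haB
    have hψr : (ψ.1 (r * d * r) : D) = r * g * r := by
      have e1 := congrArg Subtype.val (ψ.2 ⟨r, hrB⟩ (r * d)).2
      have e2 := congrArg Subtype.val (ψ.2 ⟨r, hrB⟩ d).1
      simp only [MulMemClass.coe_mul] at e1 e2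
      rw [e1, e2]
    have hrgr : ‖r * g * r‖ ≤ 1 := by
      have h0 : 0 ≤ r * g * r := hr.conjugate_nonneg hg
      rw [CStarAlgebra.norm_le_one_iff_of_nonneg _ h0]
      calc r * g * r ≤ r * a * r := hr.conjugate_le_conjugate (by
            rw [hadef]; exact le_add_of_nonneg_right hεp.nonneg)
        _ = 1 := CFC.conjugate_rpow_neg_one_half a ha
    have hd0 : 0 ≤ r * d * r := hr.conjugate_nonneg hd
    have hdn : ‖r * d * r‖ ≤ K := by
      refine (hn _ hd0).trans (mul_le_of_le_one_right hK ?_)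
      change ‖(ψ.1 (r * d * r) : D)‖ ≤ 1
      rwa [hψr]
    rw [CStarAlgebra.norm_le_iff_le_algebraMap _ hK hd0] at hdn
    -- Conjugating by `q = r⁻¹` undoes the normalization and turns the scalar bound `K` into `K •
    -- a`.
    have := hq.conjugate_le_conjugate hdn
    calc d = q * (r * d * r) * q := by
          rw [show q * (r * d * r) * q = (q * r) * d * (r * q) by simp only [mul_assoc], hqr, hrq,
            one_mul, mul_one]
      _ ≤ q * algebraMap ℝ D K * q := this
      _ = K • a := by rw [← hqq, Algebra.algebraMap_eq_smul_one]; simp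
  have hlim : Filter.Tendsto (fun ε : ℝ => K • (g + algebraMap ℝ D ε))
      (nhdsWithin 0 (Set.Ioi 0)) (nhds (K • g)) := by
    have : Continuous fun ε : ℝ => K • (g + algebraMap ℝ D ε) := by fun_prop
    simpa using (this.tendsto 0).mono_left nhdsWithin_le_nhds
  exact ge_of_tendsto hlim (Filter.eventually_of_mem self_mem_nhdsWithin main)

section Transfer

variable {C D Y : Type*} [CStarAlgebra C] [PartialOrder C] [CStarAlgebra D] [PartialOrder D]
  [NormedAddCommGroup Y] [NormedSpace ℂ Y] [Module C Y] [Module Dᵐᵒᵖ Y]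
  [CStarModule C Y] [CStarModule Dᵐᵒᵖ Y] [StarOrderedRing C] [StarOrderedRing D]
  [IsScalarTower ℂ C Y] [IsScalarTower ℂ Dᵐᵒᵖ Y] [SMulCommClass C Dᵐᵒᵖ Y]

theorem IsMoritaEquivalence.isTransfer_transfer {A : StarSubalgebra ℂ C} {B : StarSubalgebra ℂ D}
    {X : Submodule ℂ Y} (h : IsMoritaEquivalence A B X) (φ : bimoduleMaps A) :
    IsTransfer φ (h.existsUnique_transfer φ).choose.1 (h.transfer φ) :=
  (h.existsUnique_transfer φ).choose_spec.1

end Transfer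

end CStarInclusion

theorem proposition3p6 {C D Y : Type*}
    [CStarAlgebra C] [PartialOrder C] [StarOrderedRing C]
    [CStarAlgebra D] [PartialOrder D] [StarOrderedRing D]
    [NormedAddCommGroup Y] [NormedSpace ℂ Y] [Module C Y] [Module Dᵐᵒᵖ Y]
    [IsScalarTower ℂ C Y] [IsScalarTower ℂ Dᵐᵒᵖ Y] [SMulCommClass C Dᵐᵒᵖ Y]
    [CStarModule C Y] [CStarModule Dᵐᵒᵖ Y]
    (A : StarSubalgebra ℂ C) (B : StarSubalgebra ℂ D) (X : Submodule ℂ Y)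
    (h : CStarInclusion.IsMoritaEquivalence A B X)
    (φ : CStarInclusion.bimoduleMaps A) (hφ : CStarInclusion.IsConditionalExpectation φ)
    (ht : ∃ t : ℝ, 0 < t ∧ ∀ c : C, 0 ≤ c → t • c ≤ (φ.1 c : C)) :
    ∃ s : ℝ, 0 < s ∧ ∀ d : D, 0 ≤ d → s • d ≤ ((h.transfer φ).1 d : D) := by
  obtain ⟨t, ht, htφ⟩ := ht
  have hT := h.isTransfer_transfer φ
  obtain ⟨K, hK, hKn⟩ := hT.exists_norm_le h ht htφ
  -- `K` is only known to be nonnegative; `K + 1` is a strictly positive bound that can be inverted.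
  refine ⟨(K + 1)⁻¹, by positivity, fun d hd => ?_⟩
  have hg := hT.nonneg h hφ.nonneg hd
  have hle := CStarInclusion.le_smul_of_norm_le h.isClosed_right (h.transfer φ)
    (fun d hd => hT.nonneg h hφ.nonneg hd) (by positivity : 0 ≤ K + 1)
    (fun d hd => (hKn d hd).trans (by gcongr; linarith)) hd
  have := smul_le_smul_of_nonneg_left hle (by positivity : 0 ≤ (K + 1)⁻¹)
  rwa [smul_smul, inv_mul_cancel₀ (by positivity), one_smul] at this
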